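/- Let $L\ge 1$ be an integer, let $(p^L_1,\dots,p^L_{2^L})$ be a probability vector (the distribution of the binary words of length $L$) and let $j\in\{1,\dots,2^L\}$. For $t\in\mathbb R$ and $x\in[0,1]$ put $$g_j(t,x)=\exp\left(i t\left[p^L_j x\log_2(p^L_j x)+p^L_j (1-x)\log_2(p^L_j (1-x))-p^L_j\log_2\left(\frac{p^L_j}{2}\right)\right]\right),$$ with the convention $0\log_2 0=0$. For $n_j\ge 1$ let $X\sim\mathrm{Bin}(n_j,1/2)$. Then, for every $t\in\mathbb R$, $$\mathbb E\left[g_j\left(t,\frac{X}{n_j}\right)\right]=1+\frac{i t p^L_j}{2\ln(2)\,n_j}+R(t,n_j),$$ where, for every integer $q\ge 2$ and every $\varepsilon>1$, there exists $\nu\in\mathbb N$ (which may depend on $p^L_j,t,q,\varepsilon$) such that, for all $n_j\ge\nu$, $$|R(t,n_j)|\le\frac{\varepsilon}{96}\,(q-1)^{1-1/q}\,(4q-1)^{3}\left(\sum_{l=1}^{4}\left|\frac{2^5\,t\,p^L_j}{15\ln(2)}\right|^{l}\frac{\mathcal L(4,l)}{(5ql-1)^{1/q}}\right)n_j^{-2+\frac{1}{2q}},$$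 and $\mathcal L(k,l)=\binom{k-1}{l-1}\frac{k!}{l!}$ denotes the Lah number. -/

import Mathlib

open MeasureTheory ProbabilityTheory

/-- The success probability `1/2`, as a point of the unit interval. -/
noncomputable def halfProb : unitInterval := ⟨1 / 2, by norm_num, by norm_num⟩

/-- The real number
`p x log₂(p x) + p (1 - x) log₂(p (1 - x)) - p log₂(p / 2)`.
Since `Real.logb 2 0 = 0`, this follows the convention `0 log₂ 0 = 0`, so that the expression is
also meaningful (and continuous in `x`) at `x = 0` and `x = 1`, and for `p = 0`. -/
noncomputable def infoSummand (p x : ℝ) : ℝ :=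
  p * x * Real.logb 2 (p * x) + p * (1 - x) * Real.logb 2 (p * (1 - x)) - p * Real.logb 2 (p / 2)

/-- The function `g_j(t, x)`, for the prefix distribution `p = (p_i)_i`. -/
noncomputable def gFun {L : ℕ} (p : Fin (2 ^ L) → ℝ) (j : Fin (2 ^ L)) (t x : ℝ) : ℂ :=
  Complex.exp (Complex.I * (t : ℂ) * (infoSummand (p j) x : ℂ))

/-- The Lah number `(k-1 choose l-1) k! / l!`, for `1 ≤ l ≤ k`. -/
noncomputable def lahNumber (k l : ℕ) : ℝ :=
  ((k - 1).choose (l - 1) : ℝ) * ((k.factorial : ℝ) / (l.factorial : ℝ))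

/-- The constant multiplying `ε n ^ (-2 + 1 / (2 q))` in the error bound, for a prefix
probability `p`. -/
noncomputable def errorConst (p t : ℝ) (q : ℕ) : ℝ :=
  1 / 96 * ((q : ℝ) - 1) ^ (1 - 1 / (q : ℝ)) * (4 * (q : ℝ) - 1) ^ 3 *
    ∑ l ∈ Finset.Icc 1 4, |2 ^ 5 * t * p / (15 * Real.log 2)| ^ l *
      (lahNumber 4 l / (5 * (q : ℝ) * (l : ℝ) - 1) ^ (1 / (q : ℝ)))

/-! With `y = 2x - 1` and `a = t p_j / ln 2`, the exponent is `i a (log 2 - H(x))`, `H` the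
natural-log binary entropy (`infoSummand_eq`). As `log 2 - H(x) = y²/2 + O(y⁴)` on all of `[0, 1]`,
also `g_j = 1 + i a y²/2 + O(y⁴)` (`norm_gFun_sub_le`). Since `E y² = 1/n` exactly and `E y⁴ ≤
3/n²`, the remainder is `O(n⁻²)`. The claimed rate is larger by `n^(1/(2q))`, so any positive
constant works for large `n`. -/

/-- Summing a function against the `n + 1`-st row of Pascal's triangle, by Pascal's rule. -/
theorem sum_choose_succ_mul_real (f : ℕ → ℝ) (n : ℕ) :
    ∑ k ∈ Finset.range (n + 2), ((n + 1).choose k : ℝ) * f k =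
      ∑ k ∈ Finset.range (n + 1), (n.choose k : ℝ) * (f k + f (k + 1)) := by
  have h := Finset.sum_choose_succ_mul (fun i _ => f i) n
  simp only [mul_add, Finset.sum_add_distrib]
  linarith

/-- The second central moment of the symmetric binomial distribution. -/
theorem sum_choose_mul_central_sq (n : ℕ) :
    ∑ k ∈ Finset.range (n + 1), (n.choose k : ℝ) * (2 * (k : ℝ) - n) ^ 2 = 2 ^ n * (n : ℝ) := by
  induction n with
  | zero => simp
  | succ n ih =>
    have h0 : ∑ k ∈ Finset.range (n + 1), (n.choose k : ℝ) = 2 ^ n := by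
      exact_mod_cast Nat.sum_range_choose n
    rw [sum_choose_succ_mul_real]
    -- With `z = 2k - n`, Pascal's rule pairs `z - 1` with `z + 1`, and `(z - 1)² + (z + 1)² = 2z² +
    -- 2`.
    calc _ = ∑ k ∈ Finset.range (n + 1),
          (2 * ((n.choose k : ℝ) * (2 * (k : ℝ) - n) ^ 2) + 2 * (n.choose k : ℝ)) :=
          Finset.sum_congr rfl fun k _ => by push_cast; ring
      _ = _ := by
        rw [Finset.sum_add_distrib, ← Finset.mul_sum, ← Finset.mul_sum, ih, h0]
        push_cast; ring

/-- The fourth central moment of the symmetric binomial distribution. -/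
theorem sum_choose_mul_central_pow_four (n : ℕ) :
    ∑ k ∈ Finset.range (n + 1), (n.choose k : ℝ) * (2 * (k : ℝ) - n) ^ 4 =
      2 ^ n * (3 * (n : ℝ) ^ 2 - 2 * n) := by
  induction n with
  | zero => simp
  | succ n ih =>
    have h0 : ∑ k ∈ Finset.range (n + 1), (n.choose k : ℝ) = 2 ^ n := by
      exact_mod_cast Nat.sum_range_choose n
    rw [sum_choose_succ_mul_real]
    calc _ = ∑ k ∈ Finset.range (n + 1),
          (2 * ((n.choose k : ℝ) * (2 * (k : ℝ) - n) ^ 4)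
            + 12 * ((n.choose k : ℝ) * (2 * (k : ℝ) - n) ^ 2) + 2 * (n.choose k : ℝ)) :=
          Finset.sum_congr rfl fun k _ => by push_cast; ring
      _ = _ := by
        rw [Finset.sum_add_distrib, Finset.sum_add_distrib, ← Finset.mul_sum, ← Finset.mul_sum,
          ← Finset.mul_sum, ih, h0, sum_choose_mul_central_sq]
        push_cast; ring

/-- Integration against the symmetric binomial distribution, as a finite sum. -/
theorem integral_binomial_halfProb (n : ℕ) (f : ℕ → ℝ) :
    ∫ k, f k ∂(binomial n halfProb) =
      (∑ k ∈ Finset.range (n + 1), (n.choose k : ℝ) * f k) / 2 ^ n := by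
  rw [integral_binomial, Finset.sum_div]
  refine Finset.sum_congr (by ext; simp) fun k hk => ?_
  have hk : k ≤ n := by simpa using hk
  have h : ((1 : ℝ) / 2) ^ k * (1 - 1 / 2) ^ (n - k) = 1 / 2 ^ n := by
    rw [show (1 : ℝ) - 1 / 2 = 1 / 2 by norm_num, ← pow_add, Nat.add_sub_cancel' hk,
      div_pow, one_pow]
  simp only [halfProb, smul_eq_mul, mul_assoc]
  rw [← mul_assoc (((1 : ℝ) / 2) ^ k), h]
  ring

theorem integral_binomial_halfProb_sq {n : ℕ} (hn : 1 ≤ n) :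
    ∫ k, (2 * ((k : ℝ) / n) - 1) ^ 2 ∂(binomial n halfProb) = 1 / (n : ℝ) := by
  have hn' : (n : ℝ) ≠ 0 := by positivity
  have h : ∀ k : ℕ, (n.choose k : ℝ) * (2 * ((k : ℝ) / n) - 1) ^ 2 =
      (n.choose k : ℝ) * (2 * (k : ℝ) - n) ^ 2 / (n : ℝ) ^ 2 := fun k => by field_simp
  rw [integral_binomial_halfProb]
  simp only [h]
  rw [← Finset.sum_div, sum_choose_mul_central_sq]
  field_simp

theorem integral_binomial_halfProb_pow_four_le {n : ℕ} (hn : 1 ≤ n) :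
    ∫ k, (2 * ((k : ℝ) / n) - 1) ^ 4 ∂(binomial n halfProb) ≤ 3 / (n : ℝ) ^ 2 := by
  have hn' : (0 : ℝ) < n := by positivity
  have h : ∀ k : ℕ, (n.choose k : ℝ) * (2 * ((k : ℝ) / n) - 1) ^ 4 =
      (n.choose k : ℝ) * (2 * (k : ℝ) - n) ^ 4 / (n : ℝ) ^ 4 := fun k => by field_simp
  rw [integral_binomial_halfProb]
  simp only [h]
  rw [← Finset.sum_div, sum_choose_mul_central_pow_four,
    show (2 : ℝ) ^ n * (3 * (n : ℝ) ^ 2 - 2 * n) / (n : ℝ) ^ 4 / 2 ^ n =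
      3 / (n : ℝ) ^ 2 - 2 / (n : ℝ) ^ 3 by field_simp]
  have : 0 ≤ 2 / (n : ℝ) ^ 3 := by positivity
  linarith

/-- `(1 + y) log (1 + y)` agrees with its Taylor polynomial up to `O(y ^ 4)` near `0`. -/
theorem abs_one_add_mul_log_one_add_sub_le {y : ℝ} (hy : |y| ≤ 1 / 2) :
    |(1 + y) * Real.log (1 + y) - (1 + y) * (y - y ^ 2 / 2 + y ^ 3 / 3)| ≤ 3 * y ^ 4 := by
  have h := Real.abs_log_sub_add_sum_range_le (x := -y) (by rw [abs_neg]; linarith) 3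
  rw [abs_neg, show |y| ^ (3 + 1) = y ^ 4 by rw [Even.pow_abs (by decide)]] at h
  have h1 : y ^ 4 / (1 - |y|) ≤ 2 * y ^ 4 := by
    rw [div_le_iff₀ (by linarith)]
    nlinarith [show 0 ≤ y ^ 4 by positivity]
  obtain ⟨hy1, hy2⟩ := abs_le.1 hy
  have h2 : |Real.log (1 + y) - (y - y ^ 2 / 2 + y ^ 3 / 3)| ≤ 2 * y ^ 4 := by
    refine le_trans (le_of_eq ?_) (h.trans h1)
    congr 1
    simp only [Finset.sum_range_succ, Finset.sum_range_zero, sub_neg_eq_add]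
    push_cast
    ring
  rw [← mul_sub, abs_mul, abs_of_nonneg (by linarith : 0 ≤ 1 + y)]
  calc (1 + y) * |Real.log (1 + y) - (y - y ^ 2 / 2 + y ^ 3 / 3)|
      ≤ (3 / 2) * (2 * y ^ 4) := by gcongr; linarith
    _ = 3 * y ^ 4 := by ring

/-- Symmetrizing in `±(2x - 1)` makes the odd Taylor terms cancel. -/
theorem log_two_sub_binEntropy_eq {x : ℝ} (hx0 : 0 < x) (hx1 : x < 1) :
    Real.log 2 - Real.binEntropy x =
      ((1 + (2 * x - 1)) * Real.log (1 + (2 * x - 1))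
        + (1 + -(2 * x - 1)) * Real.log (1 + -(2 * x - 1))) / 2 := by
  rw [show 1 + (2 * x - 1) = 2 * x by ring, show 1 + -(2 * x - 1) = 2 * (1 - x) by ring,
    Real.log_mul two_ne_zero hx0.ne', Real.log_mul two_ne_zero (by linarith), Real.binEntropy,
    Real.log_inv, Real.log_inv]
  ring

/-- The quadratic approximation of the binary entropy around `1 / 2`. -/
theorem abs_log_two_sub_binEntropy_sub_le {x : ℝ} (hx0 : 0 ≤ x) (hx1 : x ≤ 1) :
    |Real.log 2 - Real.binEntropy x - (2 * x - 1) ^ 2 / 2| ≤ 16 * (2 * x - 1) ^ 4 := by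
  rcases le_or_gt |2 * x - 1| (1 / 2) with h | h
  · obtain ⟨h1, h2⟩ := abs_le.1 h
    rw [log_two_sub_binEntropy_eq (by linarith) (by linarith)]
    have ha := abs_le.1 (abs_one_add_mul_log_one_add_sub_le h)
    have hb := abs_le.1 (abs_one_add_mul_log_one_add_sub_le (y := -(2 * x - 1)) (by rwa [abs_neg]))
    generalize 2 * x - 1 = y at *
    have : 0 ≤ y ^ 4 := by positivity
    rw [abs_le]
    -- The Taylor polynomials at `±y` average to `y²/2 + y⁴/3`.
    constructor <;> nlinarith [ha.1, ha.2, hb.1, hb.2]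
  -- Away from `1/2` both compared quantities lie in `[0, 1]`, while `16 y⁴ ≥ 1`.
  · have h1 := Real.binEntropy_nonneg hx0 hx1
    have h2 := Real.binEntropy_le_log_two (p := x)
    have h3 : Real.log 2 ≤ 1 := by linarith [Real.log_two_lt_d9]
    have h4 : (2 * x - 1) ^ 2 ≤ 1 := by nlinarith
    have h5 : 1 / 4 < (2 * x - 1) ^ 2 := by rw [← sq_abs]; nlinarith
    have h6 : 1 ≤ 16 * (2 * x - 1) ^ 4 := by
      nlinarith [show (2 * x - 1) ^ 4 = ((2 * x - 1) ^ 2) ^ 2 by ring]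
    rw [abs_le]
    constructor <;> nlinarith

theorem mul_logb_two_mul {p : ℝ} (hp : p ≠ 0) (x : ℝ) :
    p * x * Real.logb 2 (p * x) = p / Real.log 2 * (x * Real.log p + x * Real.log x) := by
  rcases eq_or_ne x 0 with rfl | hx
  · simp
  · rw [Real.logb, Real.log_mul hp hx]
    ring

/-- The information summand is a multiple of the deficit of the binary entropy. -/
theorem infoSummand_eq (p x : ℝ) :
    infoSummand p x = p / Real.log 2 * (Real.log 2 - Real.binEntropy x) := by
  rcases eq_or_ne p 0 with rfl | hp
  · simp [infoSummand]
  · rw [infoSummand, mul_logb_two_mul hp, mul_logb_two_mul hp, Real.logb,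
      Real.log_div hp two_ne_zero, Real.binEntropy, Real.log_inv, Real.log_inv]
    ring

/-- Taylor for `|s| ≤ 1`; otherwise the triangle inequality gives `2|s| ≤ 2s²`. -/
theorem norm_exp_I_mul_sub_one_sub_le (s : ℝ) :
    ‖Complex.exp (Complex.I * s) - 1 - Complex.I * s‖ ≤ 2 * s ^ 2 := by
  have hs : ‖Complex.I * (s : ℂ)‖ = |s| := by simp
  rcases le_or_gt |s| 1 with h | h
  · refine (Complex.norm_exp_sub_one_sub_id_le (hs.trans_le h)).trans ?_
    rw [hs, sq_abs]
    nlinarith [sq_nonneg s]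
  · have h1 : ‖Complex.exp (Complex.I * s) - 1‖ ≤ |s| := Real.norm_exp_I_mul_ofReal_sub_one_le
    refine (norm_sub_le _ _).trans ?_
    rw [hs]
    nlinarith [sq_abs s]

/-- Uniformly in `x`, `g_j(t, x)` is approximated to fourth order around `x = 1 / 2`. -/
theorem norm_gFun_sub_le {L : ℕ} (p : Fin (2 ^ L) → ℝ) (j : Fin (2 ^ L)) (t : ℝ) {x a : ℝ}
    (ha : a = t * p j / Real.log 2) (hx0 : 0 ≤ x) (hx1 : x ≤ 1) :
    ‖gFun p j t x - (1 + Complex.I * ((a / 2 * (2 * x - 1) ^ 2 : ℝ) : ℂ))‖ ≤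
      (578 * a ^ 2 + 16 * |a|) * (2 * x - 1) ^ 4 := by
  have hφ := abs_log_two_sub_binEntropy_sub_le hx0 hx1
  set φ := Real.log 2 - Real.binEntropy x with hφ_def
  have hy : (2 * x - 1) ^ 2 ≤ 1 := by nlinarith
  set y := 2 * x - 1
  have hg : gFun p j t x = Complex.exp (Complex.I * ((a * φ : ℝ) : ℂ)) := by
    rw [gFun, infoSummand_eq, ha, mul_assoc, ← Complex.ofReal_mul]
    congr 3
    ring
  -- `17 ≥ 16 + 1/2` and `289 = 17²`; doubling gives the `578`.
  have hsq : φ ^ 2 ≤ 289 * y ^ 4 := by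
    have h4 : y ^ 4 ≤ y ^ 2 := by nlinarith [sq_nonneg y]
    have : |φ| ≤ 17 * y ^ 2 := by
      obtain ⟨h1, h2⟩ := abs_le.1 hφ
      rw [abs_le]
      constructor <;> nlinarith [sq_nonneg y]
    calc φ ^ 2 = |φ| ^ 2 := (sq_abs φ).symm
      _ ≤ (17 * y ^ 2) ^ 2 := by gcongr
      _ = 289 * y ^ 4 := by ring
  have hsplit : gFun p j t x - (1 + Complex.I * ((a / 2 * y ^ 2 : ℝ) : ℂ)) =
      (Complex.exp (Complex.I * ((a * φ : ℝ) : ℂ)) - 1 - Complex.I * ((a * φ : ℝ) : ℂ)) +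
        Complex.I * ((a * (φ - y ^ 2 / 2) : ℝ) : ℂ) := by
    rw [hg]
    push_cast
    ring
  rw [hsplit]
  refine (norm_add_le _ _).trans ?_
  have h1 := norm_exp_I_mul_sub_one_sub_le (a * φ)
  have h2 : ‖Complex.I * ((a * (φ - y ^ 2 / 2) : ℝ) : ℂ)‖ ≤ |a| * (16 * y ^ 4) := by
    rw [norm_mul, Complex.norm_I, one_mul, Complex.norm_real, Real.norm_eq_abs, abs_mul]
    gcongr
  have h3 : a ^ 2 * φ ^ 2 ≤ a ^ 2 * (289 * y ^ 4) := by gcongr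
  nlinarith

/-- The remainder in the expansion of the characteristic function. -/
noncomputable def charRemainder {L : ℕ} (p : Fin (2 ^ L) → ℝ) (j : Fin (2 ^ L)) (t : ℝ) (n : ℕ) :
    ℂ :=
  (∫ k, gFun p j t ((k : ℝ) / n) ∂(binomial n halfProb)) -
    (1 + Complex.I * (t : ℂ) * (p j : ℂ) / (2 * (Real.log 2 : ℂ) * (n : ℂ)))

theorem norm_charRemainder_le {L : ℕ} (p : Fin (2 ^ L) → ℝ) (j : Fin (2 ^ L)) (t : ℝ) {a : ℝ}
    (ha : a = t * p j / Real.log 2) {n : ℕ} (hn : 1 ≤ n) :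
    ‖charRemainder p j t n‖ ≤ (578 * a ^ 2 + 16 * |a|) * (3 / (n : ℝ) ^ 2) := by
  have hn' : (0 : ℝ) < n := by positivity
  have hmain : ∫ k, (1 + Complex.I * ((a / 2 * (2 * ((k : ℝ) / n) - 1) ^ 2 : ℝ) : ℂ))
      ∂(binomial n halfProb) =
        1 + Complex.I * (t : ℂ) * (p j : ℂ) / (2 * (Real.log 2 : ℂ) * (n : ℂ)) := by
    rw [integral_add (integrable_binomial _) (integrable_binomial _), integral_const_mul,
      integral_complex_ofReal, integral_const_mul, integral_binomial_halfProb_sq hn, ha]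
    have : (Real.log 2 : ℂ) ≠ 0 := by
      exact_mod_cast (Real.log_pos one_lt_two).ne'
    have hnc : (n : ℂ) ≠ 0 := by exact_mod_cast hn'.ne'
    simp only [integral_const, probReal_univ, one_smul]
    push_cast
    field_simp
  rw [charRemainder, ← hmain, ← integral_sub (integrable_binomial _) (integrable_binomial _)]
  refine (norm_integral_le_integral_norm _).trans ?_
  -- The pointwise estimate needs `k / n ≤ 1`.
  have hle : ∀ᵐ k ∂(binomial n halfProb), k ≤ n := ae_le_of_hasLaw_binomial HasLaw.id
  calc _ ≤ ∫ k, (578 * a ^ 2 + 16 * |a|) * (2 * ((k : ℝ) / n) - 1) ^ 4 ∂(binomial n halfProb) := by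
        refine integral_mono_ae (integrable_binomial _) (integrable_binomial _) ?_
        filter_upwards [hle] with k hk
        refine norm_gFun_sub_le p j t ha (by positivity) ?_
        rw [div_le_one hn']
        exact_mod_cast hk
    _ ≤ _ := by
        rw [integral_const_mul]
        gcongr
        exact integral_binomial_halfProb_pow_four_le hn

theorem errorConst_pos {p t : ℝ} (h : t * p ≠ 0) {q : ℕ} (hq : 2 ≤ q) : 0 < errorConst p t q := by
  have hq' : (2 : ℝ) ≤ q := by exact_mod_cast hq
  have h1 : 0 < (q : ℝ) - 1 := by linarith
  have h2 : 0 < 4 * (q : ℝ) - 1 := by linarith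
  refine mul_pos (by positivity) (Finset.sum_pos (fun l hl => ?_) ⟨1, by simp⟩)
  obtain ⟨hl1, hl4⟩ := Finset.mem_Icc.1 hl
  have hl' : (1 : ℝ) ≤ l := by exact_mod_cast hl1
  have h3 : 0 < 5 * (q : ℝ) * l - 1 := by nlinarith
  have h4 : 0 < lahNumber 4 l := by
    have : 0 < (4 - 1).choose (l - 1) := Nat.choose_pos (by omega)
    rw [lahNumber]
    positivity
  have h5 : 0 < |2 ^ 5 * t * p / (15 * Real.log 2)| := by
    have := Real.log_pos one_lt_two
    rw [abs_pos, mul_assoc]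
    positivity
  positivity

theorem theorem2 (L : ℕ) (p : Fin (2 ^ L) → ℝ) (hp : p ∈ stdSimplex ℝ (Fin (2 ^ L)))
    (j : Fin (2 ^ L)) :
    ∃ R : ℝ → ℕ → ℂ,
      (∀ (t : ℝ) (n : ℕ), 1 ≤ n →
        ∀ (Ω : Type*) [MeasurableSpace Ω] (P : Measure Ω) [IsProbabilityMeasure P] (X : Ω → ℕ),
          HasLaw X (binomial n halfProb) P →
            Integrable (fun ω => gFun p j t ((X ω : ℝ) / (n : ℝ))) P ∧
            ∫ ω, gFun p j t ((X ω : ℝ) / (n : ℝ)) ∂P =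
              1 + Complex.I * (t : ℂ) * (p j : ℂ) / (2 * (Real.log 2 : ℂ) * (n : ℂ)) + R t n) ∧
      (∀ (t : ℝ) (q : ℕ), 2 ≤ q → ∀ ε : ℝ, 1 < ε → ∃ ν : ℕ, ∀ n : ℕ, ν ≤ n →
        ‖R t n‖ ≤ ε * errorConst (p j) t q * (n : ℝ) ^ (-2 + 1 / (2 * (q : ℝ)))) := by
  refine ⟨charRemainder p j, fun t n _ Ω _ P _ X hX => ?_, fun t q hq ε hε => ?_⟩
  · have hint : Integrable (fun k : ℕ => gFun p j t ((k : ℝ) / n)) (P.map X) := by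
      rw [hX.map_eq]
      exact integrable_binomial _
    refine ⟨hint.comp_aemeasurable hX.aemeasurable, ?_⟩
    rw [charRemainder, add_sub_cancel, ← hX.map_eq,
      integral_map hX.aemeasurable hint.aestronglyMeasurable]
  · obtain ⟨a, ha⟩ : ∃ a, a = t * p j / Real.log 2 := ⟨_, rfl⟩
    rcases eq_or_ne (t * p j) 0 with h | h
    -- Here the error constant vanishes, but so does the remainder, since `a = 0`.
    · refine ⟨1, fun n hn => (norm_charRemainder_le p j t ha hn).trans ?_⟩
      have h' : 2 ^ 5 * t * p j / (15 * Real.log 2) = 0 := by rw [mul_assoc, h]; simp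
      have hz : errorConst (p j) t q = 0 := by
        rw [errorConst, h', Finset.sum_eq_zero, mul_zero]
        intro l hl
        have : l ≠ 0 := by have := (Finset.mem_Icc.1 hl).1; omega
        simp [this]
      simp [hz, ha, h]
    · have hD := mul_pos (zero_lt_one.trans hε) (errorConst_pos h hq)
      have hq' : (0 : ℝ) < 1 / (2 * (q : ℝ)) := by positivity
      have hlim := (tendsto_rpow_atTop hq').comp (tendsto_natCast_atTop_atTop (R := ℝ))
      -- From `ν` on, `n^(1/(2q))` exceeds the ratio of the two constants.
      obtain ⟨ν, hν⟩ := Filter.eventually_atTop.1 (hlim.eventually_ge_atTop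
        ((578 * a ^ 2 + 16 * |a|) * 3 / (ε * errorConst (p j) t q)))
      refine ⟨max ν 1, fun n hn => ?_⟩
      have hn1 : 1 ≤ n := (le_max_right _ _).trans hn
      have hn' : (0 : ℝ) < n := by positivity
      have hb := hν n ((le_max_left _ _).trans hn)
      rw [Function.comp_apply, div_le_iff₀' hD] at hb
      refine (norm_charRemainder_le p j t ha hn1).trans ?_
      rw [Real.rpow_add hn', Real.rpow_neg hn'.le, Real.rpow_two]
      calc (578 * a ^ 2 + 16 * |a|) * (3 / (n : ℝ) ^ 2)
          = (578 * a ^ 2 + 16 * |a|) * 3 * ((n : ℝ) ^ 2)⁻¹ := by ring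
        _ ≤ ε * errorConst (p j) t q * (n : ℝ) ^ (1 / (2 * (q : ℝ))) * ((n : ℝ) ^ 2)⁻¹ := by
            gcongr
        _ = _ := by ring
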